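/- \textbf{Languages and models.} Fix a countable set $\mathsf{Prop}$ of variables. Let $\mathcal L^\sim$ be the language of formulas built from $\mathsf{Prop}$ by $\sim,\wedge,\vee,\to$, and let $\mathcal L^\sim_{\Box,\lozenge}$ be its extension by $\Box,\lozenge$. An $\mathsf{N4}$ model is $\langle W,\le,v^+,v^-\rangle$ with $W\ne\varnothing$, $\le$ a preorder on $W$, and $v^\pm:\mathsf{Prop}\to 2^W$ with upward closed values. A $\mathsf{CN4K}$ model has in addition four arbitrary binary relations $R^+_\Box,R^-_\Box,R^+_\lozenge,R^-_\lozenge$ on $W$. Positive and negative support are defined by: \begin{itemize} \item $w\Vdash^\pm p$ iff $w\in v^\pm(p)$; $w\Vdash^+{\sim}\phi$ iff $w\Vdash^-\phi$; $w\Vdash^-{\sim}\phi$ iff $w\Vdash^+\phi$; \item $w\Vdash^+\phi\wedge\chi$ iff $w\Vdash^+\phi$ and $w\Vdash^+\chi$; $w\Vdash^-\phi\wedge\chi$ iff $w\Vdash^-\phi$ or $w\Vdash^-\chi$; \item $w\Vdash^+\phi\vee\chi$ iff $w\Vdash^+\phi$ or $w\Vdash^+\chi$; $w\Vdash^-\phi\vee\chi$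 iff $w\Vdash^-\phi$ and $w\Vdash^-\chi$; \item $w\Vdash^+\phi\to\chi$ iff for all $w'\ge w$, $w'\Vdash^+\phi$ implies $w'\Vdash^+\chi$; $w\Vdash^-\phi\to\chi$ iff $w\Vdash^+\phi$ and $w\Vdash^-\chi$; \item $w\Vdash^+\Box\phi$ iff $\forall w'\ge w\ \forall w''\,(w'R^+_\Box w''\Rightarrow w''\Vdash^+\phi)$; $w\Vdash^-\Box\phi$ iff $\forall w'\ge w\ \exists w''\,(w'R^-_\Box w''$ and $w''\Vdash^-\phi)$; \item $w\Vdash^+\lozenge\phi$ iff $\forall w'\ge w\ \exists w''\,(w'R^+_\lozenge w''$ and $w''\Vdash^+\phi)$; $w\Vdash^-\lozenge\phi$ iff $\forall w'\ge w\ \forall w''\,(w'R^-_\lozenge w''\Rightarrow w''\Vdash^-\phi)$. \end{itemize} \textbf{Logics.} $\mathsf{N4}$ (language $\mathcal L^\sim$) is the logic of all $\mathsf{N4}$ models. In the language $\mathcal L^\sim_{\Box,\lozenge}$, $\mathsf{CN4K}$ is the logic of all $\mathsf{CN4K}$ models; $\mathsf{CN4K}^\pm$ of those with $R^+_\Box=R^+_\lozenge$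 and $R^-_\Box=R^-_\lozenge$; $\mathsf{CN4K}^\curlyvee$ of those with $R^+_\Box=R^-_\Box$ and $R^+_\lozenge=R^-_\lozenge$; $\mathsf{CN4K}^{\bowtie}$ of those with $R^+_\Box=R^-_\lozenge$ and $R^+_\lozenge=R^-_\Box$; $\mathsf{CN4K}^1$ of those in which all four relations coincide. $\mathsf L\models\phi$ means that $w\Vdash^+\phi$ at every $w$ of every model of $\mathsf L$. \textbf{Calculi.} A sequent $\Gamma\Rightarrow\phi$ consists of a finite multiset $\Gamma$ of formulas and a formula $\phi$. Let $\Gamma^\Box$ be the multiset of the $\phi$ with $\Box\phi\in\Gamma$, and $\Gamma^\lozenge_\sim$ the multiset of the ${\sim}\phi$ with ${\sim}\lozenge\phi\in\Gamma$. Rules are written premises / conclusion. All calculi contain the axioms $p,\Gamma\Rightarrow p$ and ${\sim}p,\Gamma\Rightarrow{\sim}p$ ($p\in\mathsf{Prop}$) and the rules: \begin{itemize} \item $\phi,\Gamma\Rightarrow\psi\,/\,{\sim}{\sim}\phi,\Gamma\Rightarrow\psi$; $\quad\Gamma\Rightarrow\phi\,/\,\Gamma\Rightarrow{\sim}{\sim}\phi$;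 \item $\phi,\chi,\Gamma\Rightarrow\psi\,/\,\phi\wedge\chi,\Gamma\Rightarrow\psi$; $\quad\Gamma\Rightarrow\phi$ and $\Gamma\Rightarrow\chi\,/\,\Gamma\Rightarrow\phi\wedge\chi$; \item $\phi,\Gamma\Rightarrow\psi$ and $\chi,\Gamma\Rightarrow\psi\,/\,\phi\vee\chi,\Gamma\Rightarrow\psi$; $\quad\Gamma\Rightarrow\phi\,/\,\Gamma\Rightarrow\phi\vee\chi$; $\quad\Gamma\Rightarrow\chi\,/\,\Gamma\Rightarrow\phi\vee\chi$; \item ${\sim}\phi,{\sim}\chi,\Gamma\Rightarrow\psi\,/\,{\sim}(\phi\vee\chi),\Gamma\Rightarrow\psi$; $\quad\Gamma\Rightarrow{\sim}\phi$ and $\Gamma\Rightarrow{\sim}\chi\,/\,\Gamma\Rightarrow{\sim}(\phi\vee\chi)$; \item ${\sim}\phi,\Gamma\Rightarrow\psi$ and ${\sim}\chi,\Gamma\Rightarrow\psi\,/\,{\sim}(\phi\wedge\chi),\Gamma\Rightarrow\psi$; $\quad\Gamma\Rightarrow{\sim}\phi\,/\,\Gamma\Rightarrow{\sim}(\phi\wedge\chi)$;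 $\quad\Gamma\Rightarrow{\sim}\chi\,/\,\Gamma\Rightarrow{\sim}(\phi\wedge\chi)$; \item $\phi\to\chi,\Gamma\Rightarrow\phi$ and $\chi,\Gamma\Rightarrow\psi\,/\,\phi\to\chi,\Gamma\Rightarrow\psi$; $\quad\phi,\Gamma\Rightarrow\chi\,/\,\Gamma\Rightarrow\phi\to\chi$; \item $\phi,{\sim}\chi,\Gamma\Rightarrow\psi\,/\,{\sim}(\phi\to\chi),\Gamma\Rightarrow\psi$; $\quad\Gamma\Rightarrow\phi$ and $\Gamma\Rightarrow{\sim}\chi\,/\,\Gamma\Rightarrow{\sim}(\phi\to\chi)$. \end{itemize} $\mathcal G\mathsf{N4}$ has no further rules. The modal rules are, with $\Theta$ a multiset depending on $\Gamma$: \begin{itemize} \item $(\Box,\Theta)$: $\Theta\Rightarrow\chi\,/\,\Gamma\Rightarrow\Box\chi$; $\quad({\sim}\lozenge,\Theta)$: $\Theta\Rightarrow{\sim}\chi\,/\,\Gamma\Rightarrow{\sim}\lozenge\chi$; \item $(\lozenge,\Theta)$: $\Theta,\phi\Rightarrow\chi\,/\,\Gamma,\lozenge\phi\Rightarrow\lozenge\chi$;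 $\quad({\sim}\Box,\Theta)$: $\Theta,{\sim}\phi\Rightarrow{\sim}\chi\,/\,\Gamma,{\sim}\Box\phi\Rightarrow{\sim}\Box\chi$; \item $(\lozenge^{\bowtie},\Theta)$: $\Theta,{\sim}\phi\Rightarrow\chi\,/\,\Gamma,{\sim}\Box\phi\Rightarrow\lozenge\chi$; $\quad({\sim}\Box^{\bowtie},\Theta)$: $\Theta,\phi\Rightarrow{\sim}\chi\,/\,\Gamma,\lozenge\phi\Rightarrow{\sim}\Box\chi$. \end{itemize} Writing $\Gamma^{*}$ for the multiset union of $\Gamma^\Box$ and $\Gamma^\lozenge_\sim$, the calculi add to $\mathcal G\mathsf{N4}$ (in the modal language) the rules \begin{itemize} \item $\mathcal G\mathsf{CN4K}$: $(\Box,\Gamma^\Box)$, $({\sim}\lozenge,\Gamma^\lozenge_\sim)$, $(\lozenge,\varnothing)$, $({\sim}\Box,\varnothing)$; \item $\mathcal G\mathsf{CN4K}^\pm$: $(\Box,\Gamma^\Box)$, $({\sim}\lozenge,\Gamma^\lozenge_\sim)$, $(\lozenge,\Gamma^\Box)$, $({\sim}\Box,\Gamma^\lozenge_\sim)$; \item $\mathcal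 G\mathsf{CN4K}^\curlyvee$: $(\Box,\Gamma^\Box)$, $({\sim}\lozenge,\Gamma^\lozenge_\sim)$, $(\lozenge,\Gamma^\lozenge_\sim)$, $({\sim}\Box,\Gamma^\Box)$; \item $\mathcal G\mathsf{CN4K}^{\bowtie}$: $(\Box,\Gamma^{*})$, $({\sim}\lozenge,\Gamma^{*})$, $(\lozenge,\varnothing)$, $({\sim}\Box,\varnothing)$, $(\lozenge^{\bowtie},\varnothing)$, $({\sim}\Box^{\bowtie},\varnothing)$; \item $\mathcal G\mathsf{CN4K}^1$: $(\Box,\Gamma^{*})$, $({\sim}\lozenge,\Gamma^{*})$, $(\lozenge,\Gamma^{*})$, $({\sim}\Box,\Gamma^{*})$, $(\lozenge^{\bowtie},\Gamma^{*})$, $({\sim}\Box^{\bowtie},\Gamma^{*})$. \end{itemize} There is no cut rule and there are no structural rules. $\mathcal G\mathsf L\vdash\Gamma\Rightarrow\phi$ means that $\Gamma\Rightarrow\phi$ is the root of a finite derivation tree in $\mathcal G\mathsf L$ whose leaves are axioms. \textbf{Theorem} (completeness of the sequent calculi). Let $\mathsf L\in\{\mathsf{N4},\mathsf{CN4K},\mathsf{CN4K}^\pm,\mathsf{CN4K}^\curlyvee,\mathsf{CN4K}^{\bowtie},\mathsf{CN4K}^1\}$,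 let $\Gamma$ be a finite multiset of formulas and $\phi$ a formula of the language of $\mathsf L$. If $\mathsf L\models\bigwedge_{\psi\in\Gamma}\psi\to\phi$, then $\mathcal G\mathsf L\vdash\Gamma\Rightarrow\phi$. (For $\Gamma=\varnothing$ the formula $\bigwedge_{\psi\in\Gamma}\psi\to\phi$ is read as $\phi$.) -/

import Mathlib

namespace CN4K

universe u

/-! ## Languages -/

/-- Formulas over the propositional variables `P`. The parameter `m` says whether the language
has modalities: `Form P false` is the language of `N4` (variables, strong negation, conjunction,
disjunction, implication); `Form P true` also has `□` and `◇`. -/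
inductive Form (P : Type u) (m : Bool) : Type u where
  | var (p : P) : Form P m
  | neg (φ : Form P m) : Form P m
  | and (φ χ : Form P m) : Form P m
  | or (φ χ : Form P m) : Form P m
  | imp (φ χ : Form P m) : Form P m
  | box (h : m = true) (φ : Form P m) : Form P m
  | dia (h : m = true) (φ : Form P m) : Form P m

namespace Form

variable {P : Type u} {m : Bool}

/-- The conjunction `ψ ∧ (ψ₁ ∧ (ψ₂ ∧ ⋯))` of the nonempty list `ψ :: l`. -/
def conj (ψ : Form P m) : List (Form P m) → Form P m
  | [] => ψ
  | χ :: l => .and ψ (conj χ l)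

/-- The formula `⋀ Γ → φ`. The language has no constant for truth; for empty `Γ` the formula
is `φ` itself. -/
def interp : List (Form P m) → Form P m → Form P m
  | [], φ => φ
  | ψ :: l, φ => .imp (conj ψ l) φ

end Form

/-! ## Semantics -/

/-- Models of `N4`: a nonempty preordered set with two persistent valuations. -/
structure N4Model (P : Type u) where
  W : Type u
  nonempty : Nonempty W
  le : W → W → Prop
  le_refl : ∀ w, le w w
  le_trans : ∀ w₁ w₂ w₃, le w₁ w₂ → le w₂ w₃ → le w₁ w₃
  vpos : P → Set W
  vneg : P → Set W
  vpos_mono : ∀ p w w', w ∈ vpos p → le w w' → w' ∈ vpos p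
  vneg_mono : ∀ p w w', w ∈ vneg p → le w w' → w' ∈ vneg p

mutual

/-- Support of truth in an `N4` model. -/
def N4Model.Pos {P : Type u} (M : N4Model P) : Form P false → M.W → Prop
  | .var p, w => w ∈ M.vpos p
  | .neg φ, w => M.Neg φ w
  | .and φ χ, w => M.Pos φ w ∧ M.Pos χ w
  | .or φ χ, w => M.Pos φ w ∨ M.Pos χ w
  | .imp φ χ, w => ∀ w', M.le w w' → M.Pos φ w' → M.Pos χ w'
  | .box h _, _ => nomatch h
  | .dia h _, _ => nomatch h

/-- Support of falsity in an `N4` model. -/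
def N4Model.Neg {P : Type u} (M : N4Model P) : Form P false → M.W → Prop
  | .var p, w => w ∈ M.vneg p
  | .neg φ, w => M.Pos φ w
  | .and φ χ, w => M.Neg φ w ∨ M.Neg χ w
  | .or φ χ, w => M.Neg φ w ∧ M.Neg χ w
  | .imp φ χ, w => M.Pos φ w ∧ M.Neg χ w
  | .box h _, _ => nomatch h
  | .dia h _, _ => nomatch h

end

/-- `CN4K` frames: a nonempty preordered set with four arbitrary binary relations, one for each
of the positive and negative support of `□` and `◇`. -/
structure Frame : Type (u + 1) where
  W : Type u
  nonempty : Nonempty W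
  le : W → W → Prop
  le_refl : ∀ w, le w w
  le_trans : ∀ w₁ w₂ w₃, le w₁ w₂ → le w₂ w₃ → le w₁ w₃
  boxPos : W → W → Prop
  boxNeg : W → W → Prop
  diaPos : W → W → Prop
  diaNeg : W → W → Prop

/-- `CN4K` models: a frame with two persistent valuations. -/
structure Model (P : Type u) extends Frame.{u} where
  vpos : P → Set W
  vneg : P → Set W
  vpos_mono : ∀ p w w', w ∈ vpos p → le w w' → w' ∈ vpos p
  vneg_mono : ∀ p w w', w ∈ vneg p → le w w' → w' ∈ vneg p

mutual

/-- Support of truth in a `CN4K` model. -/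
def Model.Pos {P : Type u} (M : Model P) : Form P true → M.W → Prop
  | .var p, w => w ∈ M.vpos p
  | .neg φ, w => M.Neg φ w
  | .and φ χ, w => M.Pos φ w ∧ M.Pos χ w
  | .or φ χ, w => M.Pos φ w ∨ M.Pos χ w
  | .imp φ χ, w => ∀ w', M.le w w' → M.Pos φ w' → M.Pos χ w'
  | .box _ φ, w => ∀ w', M.le w w' → ∀ w'', M.boxPos w' w'' → M.Pos φ w''
  | .dia _ φ, w => ∀ w', M.le w w' → ∃ w'', M.diaPos w' w'' ∧ M.Pos φ w''

/-- Support of falsity in a `CN4K` model. -/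
def Model.Neg {P : Type u} (M : Model P) : Form P true → M.W → Prop
  | .var p, w => w ∈ M.vneg p
  | .neg φ, w => M.Pos φ w
  | .and φ χ, w => M.Neg φ w ∨ M.Neg χ w
  | .or φ χ, w => M.Neg φ w ∧ M.Neg χ w
  | .imp φ χ, w => M.Pos φ w ∧ M.Neg χ w
  | .box _ φ, w => ∀ w', M.le w w' → ∃ w'', M.boxNeg w' w'' ∧ M.Neg φ w''
  | .dia _ φ, w => ∀ w', M.le w w' → ∀ w'', M.diaNeg w' w'' → M.Neg φ w''

end

/-! ## The six logics -/

/-- The logics `N4`, `CN4K`, `CN4K^±`, `CN4K^⋎`, `CN4K^⋈` and `CN4K¹`. -/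
inductive Logic where
  | n4
  | cn4k
  | pm
  | curly
  | join
  | one

/-- Whether the language of the logic has modalities. -/
def Logic.modal : Logic → Bool
  | .n4 => false
  | .cn4k | .pm | .curly | .join | .one => true

def Frame.PmBirelational (F : Frame.{u}) : Prop :=
  F.boxPos = F.diaPos ∧ F.boxNeg = F.diaNeg

def Frame.CurlyBirelational (F : Frame.{u}) : Prop :=
  F.boxPos = F.boxNeg ∧ F.diaPos = F.diaNeg

def Frame.JoinBirelational (F : Frame.{u}) : Prop :=
  F.boxPos = F.diaNeg ∧ F.diaPos = F.boxNeg

def Frame.Monorelational (F : Frame.{u}) : Prop :=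
  F.boxPos = F.boxNeg ∧ F.boxPos = F.diaPos ∧ F.boxPos = F.diaNeg

/-- `L ⊨ φ`: support of truth at every world of every model of the logic. -/
def Logic.Valid {P : Type u} : (L : Logic) → Form P L.modal → Prop
  | .n4, φ => ∀ (M : N4Model P) (w : M.W), M.Pos φ w
  | .cn4k, φ => ∀ (M : Model P) (w : M.W), M.Pos φ w
  | .pm, φ => ∀ M : Model P, M.PmBirelational → ∀ w : M.W, M.Pos φ w
  | .curly, φ => ∀ M : Model P, M.CurlyBirelational → ∀ w : M.W, M.Pos φ w
  | .join, φ => ∀ M : Model P, M.JoinBirelational → ∀ w : M.W, M.Pos φ w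
  | .one, φ => ∀ M : Model P, M.Monorelational → ∀ w : M.W, M.Pos φ w

/-! ## Sequent calculi

A sequent `Γ ⇒ φ` is a finite multiset `Γ` of formulas together with a formula `φ`. -/

/-- `some φ` on `□φ`, and `none` on all other formulas. -/
def Form.unbox {P : Type u} {m : Bool} : Form P m → Option (Form P m)
  | .box _ φ => some φ
  | _ => none

/-- `some (∼φ)` on `∼◇φ`, and `none` on all other formulas. -/
def Form.unNegDia {P : Type u} {m : Bool} : Form P m → Option (Form P m)
  | .neg (.dia _ φ) => some (.neg φ)
  | _ => none

/-- `Γ^□`: the multiset of the `φ` with `□φ` in `Γ`. -/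
def boxPart {P : Type u} {m : Bool} (Γ : Multiset (Form P m)) : Multiset (Form P m) :=
  Γ.filterMap Form.unbox

/-- `Γ^◇_∼`: the multiset of the `∼φ` with `∼◇φ` in `Γ`. -/
def negDiaPart {P : Type u} {m : Bool} (Γ : Multiset (Form P m)) : Multiset (Form P m) :=
  Γ.filterMap Form.unNegDia

/-- The names of the modal sequent rules. -/
inductive ModalRule where
  | box | dia | negBox | negDia
  | diaPm | negBoxPm | diaCurly | negBoxCurly
  | boxJoin | diaJoin | negBoxJoin | negDiaJoin
  | diaOne | negBoxOne | diaOneJoin | negBoxOneJoin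

/-- `ModalRule.Step r Δ ψ Γ φ`: an instance of `r` leads from the premise `Δ ⇒ ψ` to the
conclusion `Γ ⇒ φ`. -/
inductive ModalRule.Step {P : Type u} {m : Bool} : ModalRule →
    Multiset (Form P m) → Form P m → Multiset (Form P m) → Form P m → Prop where
  | box (h : m = true) (Γ : Multiset (Form P m)) (χ : Form P m) :
      Step .box (boxPart Γ) χ Γ (.box h χ)
  | dia (h : m = true) (Γ : Multiset (Form P m)) (φ χ : Form P m) :
      Step .dia {φ} χ (.dia h φ ::ₘ Γ) (.dia h χ)
  | negBox (h : m = true) (Γ : Multiset (Form P m)) (φ χ : Form P m) :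
      Step .negBox {.neg φ} (.neg χ) (.neg (.box h φ) ::ₘ Γ) (.neg (.box h χ))
  | negDia (h : m = true) (Γ : Multiset (Form P m)) (χ : Form P m) :
      Step .negDia (negDiaPart Γ) (.neg χ) Γ (.neg (.dia h χ))
  | diaPm (h : m = true) (Γ : Multiset (Form P m)) (φ χ : Form P m) :
      Step .diaPm (φ ::ₘ boxPart Γ) χ (.dia h φ ::ₘ Γ) (.dia h χ)
  | negBoxPm (h : m = true) (Γ : Multiset (Form P m)) (φ χ : Form P m) :
      Step .negBoxPm (.neg φ ::ₘ negDiaPart Γ) (.neg χ)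
        (.neg (.box h φ) ::ₘ Γ) (.neg (.box h χ))
  | diaCurly (h : m = true) (Γ : Multiset (Form P m)) (φ χ : Form P m) :
      Step .diaCurly (φ ::ₘ negDiaPart Γ) χ (.dia h φ ::ₘ Γ) (.dia h χ)
  | negBoxCurly (h : m = true) (Γ : Multiset (Form P m)) (φ χ : Form P m) :
      Step .negBoxCurly (.neg φ ::ₘ boxPart Γ) (.neg χ)
        (.neg (.box h φ) ::ₘ Γ) (.neg (.box h χ))
  | boxJoin (h : m = true) (Γ : Multiset (Form P m)) (χ : Form P m) :
      Step .boxJoin (boxPart Γ + negDiaPart Γ) χ Γ (.box h χ)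
  | diaJoin (h : m = true) (Γ : Multiset (Form P m)) (φ χ : Form P m) :
      Step .diaJoin {.neg φ} χ (.neg (.box h φ) ::ₘ Γ) (.dia h χ)
  | negBoxJoin (h : m = true) (Γ : Multiset (Form P m)) (φ χ : Form P m) :
      Step .negBoxJoin {φ} (.neg χ) (.dia h φ ::ₘ Γ) (.neg (.box h χ))
  | negDiaJoin (h : m = true) (Γ : Multiset (Form P m)) (χ : Form P m) :
      Step .negDiaJoin (boxPart Γ + negDiaPart Γ) (.neg χ) Γ (.neg (.dia h χ))
  | diaOne (h : m = true) (Γ : Multiset (Form P m)) (φ χ : Form P m) :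
      Step .diaOne (φ ::ₘ (boxPart Γ + negDiaPart Γ)) χ (.dia h φ ::ₘ Γ) (.dia h χ)
  | negBoxOne (h : m = true) (Γ : Multiset (Form P m)) (φ χ : Form P m) :
      Step .negBoxOne (.neg φ ::ₘ (boxPart Γ + negDiaPart Γ)) (.neg χ)
        (.neg (.box h φ) ::ₘ Γ) (.neg (.box h χ))
  | diaOneJoin (h : m = true) (Γ : Multiset (Form P m)) (φ χ : Form P m) :
      Step .diaOneJoin (.neg φ ::ₘ (boxPart Γ + negDiaPart Γ)) χ
        (.neg (.box h φ) ::ₘ Γ) (.dia h χ)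
  | negBoxOneJoin (h : m = true) (Γ : Multiset (Form P m)) (φ χ : Form P m) :
      Step .negBoxOneJoin (φ ::ₘ (boxPart Γ + negDiaPart Γ)) (.neg χ)
        (.dia h φ ::ₘ Γ) (.neg (.box h χ))

/-- Provability of sequents in the cut-free calculus with the propositional rules of `GN4` and
the modal rules in `R`. -/
inductive Provable {P : Type u} {m : Bool} (R : Set ModalRule) :
    Multiset (Form P m) → Form P m → Prop where
  | ax (Γ : Multiset (Form P m)) (p : P) : Provable R (.var p ::ₘ Γ) (.var p)
  | axNeg (Γ : Multiset (Form P m)) (p : P) :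
      Provable R (.neg (.var p) ::ₘ Γ) (.neg (.var p))
  | negNegL (Γ : Multiset (Form P m)) (φ ψ : Form P m) :
      Provable R (φ ::ₘ Γ) ψ → Provable R (.neg (.neg φ) ::ₘ Γ) ψ
  | negNegR (Γ : Multiset (Form P m)) (φ : Form P m) :
      Provable R Γ φ → Provable R Γ (.neg (.neg φ))
  | andL (Γ : Multiset (Form P m)) (φ χ ψ : Form P m) :
      Provable R (φ ::ₘ χ ::ₘ Γ) ψ → Provable R (.and φ χ ::ₘ Γ) ψ
  | andR (Γ : Multiset (Form P m)) (φ χ : Form P m) :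
      Provable R Γ φ → Provable R Γ χ → Provable R Γ (.and φ χ)
  | orL (Γ : Multiset (Form P m)) (φ χ ψ : Form P m) :
      Provable R (φ ::ₘ Γ) ψ → Provable R (χ ::ₘ Γ) ψ → Provable R (.or φ χ ::ₘ Γ) ψ
  | orR₁ (Γ : Multiset (Form P m)) (φ χ : Form P m) :
      Provable R Γ φ → Provable R Γ (.or φ χ)
  | orR₂ (Γ : Multiset (Form P m)) (φ χ : Form P m) :
      Provable R Γ χ → Provable R Γ (.or φ χ)
  | negOrL (Γ : Multiset (Form P m)) (φ χ ψ : Form P m) :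
      Provable R (.neg φ ::ₘ .neg χ ::ₘ Γ) ψ → Provable R (.neg (.or φ χ) ::ₘ Γ) ψ
  | negOrR (Γ : Multiset (Form P m)) (φ χ : Form P m) :
      Provable R Γ (.neg φ) → Provable R Γ (.neg χ) → Provable R Γ (.neg (.or φ χ))
  | negAndL (Γ : Multiset (Form P m)) (φ χ ψ : Form P m) :
      Provable R (.neg φ ::ₘ Γ) ψ → Provable R (.neg χ ::ₘ Γ) ψ →
        Provable R (.neg (.and φ χ) ::ₘ Γ) ψ
  | negAndR₁ (Γ : Multiset (Form P m)) (φ χ : Form P m) :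
      Provable R Γ (.neg φ) → Provable R Γ (.neg (.and φ χ))
  | negAndR₂ (Γ : Multiset (Form P m)) (φ χ : Form P m) :
      Provable R Γ (.neg χ) → Provable R Γ (.neg (.and φ χ))
  | impL (Γ : Multiset (Form P m)) (φ χ ψ : Form P m) :
      Provable R (.imp φ χ ::ₘ Γ) φ → Provable R (χ ::ₘ Γ) ψ →
        Provable R (.imp φ χ ::ₘ Γ) ψ
  | impR (Γ : Multiset (Form P m)) (φ χ : Form P m) :
      Provable R (φ ::ₘ Γ) χ → Provable R Γ (.imp φ χ)
  | negImpL (Γ : Multiset (Form P m)) (φ χ ψ : Form P m) :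
      Provable R (φ ::ₘ .neg χ ::ₘ Γ) ψ → Provable R (.neg (.imp φ χ) ::ₘ Γ) ψ
  | negImpR (Γ : Multiset (Form P m)) (φ χ : Form P m) :
      Provable R Γ φ → Provable R Γ (.neg χ) → Provable R Γ (.neg (.imp φ χ))
  | modal (r : ModalRule) (hr : r ∈ R) (Δ : Multiset (Form P m)) (ψ : Form P m)
      (Γ : Multiset (Form P m)) (φ : Form P m) (hs : r.Step Δ ψ Γ φ) :
      Provable R Δ ψ → Provable R Γ φ

/-- The modal rules of the sequent calculus of each logic. -/
def Logic.modalRules : Logic → Set ModalRule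
  | .n4 => ∅
  | .cn4k => {.box, .dia, .negBox, .negDia}
  | .pm => {.box, .diaPm, .negBoxPm, .negDia}
  | .curly => {.box, .diaCurly, .negBoxCurly, .negDia}
  | .join => {.boxJoin, .dia, .diaJoin, .negBox, .negBoxJoin, .negDiaJoin}
  | .one => {.boxJoin, .diaOne, .diaOneJoin, .negBoxOne, .negBoxOneJoin, .negDiaJoin}

/-- `GL ⊢ Γ ⇒ φ`. -/
def Logic.SequentProvable {P : Type u} (L : Logic)
    (Γ : Multiset (Form P L.modal)) (φ : Form P L.modal) : Prop :=
  Provable L.modalRules Γ φ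

end CN4K

/-!
Completeness of the cut-free calculi is proved contrapositively, with one canonical countermodel
construction for all six logics.

*Worlds.* A world is a set `X` of formulas that have to be supported, together with a finite
multiset `Γ`, the residue left after all invertible left rules have been applied backwards to the
antecedent (an implication `φ → χ` is replaced by `χ` as soon as `Γ ⇒ φ` is provable). `X` records
every formula met on the way, so that a member of `X` either has been decomposed inside `X` or
still lies in `Γ`. Worlds are ordered by inclusion of their sets `X`. Since rules are only applied
to the residue, neither weakening nor contraction nor cut has to be shown admissible. Every
decomposition step lowers a weight, so each refutable sequent gives a world
(`exists_world_of_refutes`).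

*Accessibility.* A world also carries an optional goal that its residue does not prove. A relation
used for `□φ` (or `∼◇φ`) passes the bodies of the boxed formulas of the residue on to the
successors; a relation used for `◇φ` (or `∼□φ`) forbids successors that prove the body of the goal,
if the goal is of that shape. Thus a world with goal `◇χ` has no successor supporting `χ`, while a
world with no goal sees enough successors to refute boxes. Which relations coincide is encoded by a
colouring of the four slots; each relation depends on its colour only, so the frame conditions hold
by definition, and the modal rules of each calculus are the ones the colouring calls for
(`ModalClosed`, `Logic.modalClosed`).

*Truth lemma* (`truth`). At each world, the members of `X` are supported, and the formulas not
provable from the residue are not supported.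

The language of `N4` is embedded in the modal one (`Form.toModal`), and an `N4` countermodel is
the canonical model with its relations forgotten.
-/

namespace CN4K

universe u

variable {P : Type u} {m : Bool}

/-! ### The embedding in the modal language -/

/-- The inclusion of `Form P m` in the modal language; the identity for `m = true`. -/
def Form.toModal : Form P m → Form P true
  | .var p => .var p
  | .neg φ => .neg φ.toModal
  | .and φ χ => .and φ.toModal χ.toModal
  | .or φ χ => .or φ.toModal χ.toModal
  | .imp φ χ => .imp φ.toModal χ.toModal
  | .box _ φ => .box rfl φ.toModal
  | .dia _ φ => .dia rfl φ.toModal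

theorem Form.toModal_eq_self (φ : Form P true) : φ.toModal = φ := by
  induction φ <;> simp_all [Form.toModal]

theorem Model.pos_toModal (M : Model P) (w : M.W) {φ : Form P true} (h : M.Pos φ w) :
    M.Pos φ.toModal w := by
  rwa [Form.toModal_eq_self]

/-- The `N4` model obtained by forgetting the four relations. -/
def Model.toN4Model (M : Model P) : N4Model P where
  W := M.W
  nonempty := M.nonempty
  le := M.le
  le_refl := M.le_refl
  le_trans := M.le_trans
  vpos := M.vpos
  vneg := M.vneg
  vpos_mono := M.vpos_mono
  vneg_mono := M.vneg_mono

theorem Model.toN4Model_support (M : Model P) (φ : Form P false) :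
    ∀ w : M.W, (M.toN4Model.Pos φ w ↔ M.Pos φ.toModal w) ∧
      (M.toN4Model.Neg φ w ↔ M.Neg φ.toModal w) := by
  induction φ with
  | var p => intro w; exact ⟨Iff.rfl, Iff.rfl⟩
  | neg φ ih =>
    intro w
    simp only [N4Model.Pos, N4Model.Neg, Form.toModal, Model.Pos, Model.Neg]
    exact ⟨(ih w).2, (ih w).1⟩
  | and φ χ ihφ ihχ =>
    intro w
    simp only [N4Model.Pos, N4Model.Neg, Form.toModal, Model.Pos, Model.Neg]
    exact ⟨and_congr (ihφ w).1 (ihχ w).1, or_congr (ihφ w).2 (ihχ w).2⟩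
  | or φ χ ihφ ihχ =>
    intro w
    simp only [N4Model.Pos, N4Model.Neg, Form.toModal, Model.Pos, Model.Neg]
    exact ⟨or_congr (ihφ w).1 (ihχ w).1, and_congr (ihφ w).2 (ihχ w).2⟩
  | imp φ χ ihφ ihχ =>
    intro w
    simp only [N4Model.Pos, N4Model.Neg, Form.toModal, Model.Pos, Model.Neg]
    exact ⟨forall_congr' fun w' => imp_congr Iff.rfl (imp_congr (ihφ w').1 (ihχ w').1),
      and_congr (ihφ w).1 (ihχ w).2⟩
  | box h _ _ => exact nomatch h
  | dia h _ _ => exact nomatch h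

theorem Model.pos_conj (M : Model P) (w : M.W) (l : List (Form P m)) :
    ∀ ψ : Form P m, M.Pos ψ.toModal w → (∀ χ ∈ l, M.Pos χ.toModal w) →
      M.Pos (Form.conj ψ l).toModal w := by
  induction l with
  | nil => intro ψ h _; exact h
  | cons χ l ih =>
    intro ψ h hl
    simp only [List.forall_mem_cons] at hl
    simp only [Form.conj, Form.toModal, Model.Pos]
    exact ⟨h, ih χ hl.1 hl.2⟩

theorem Model.pos_of_pos_interp (M : Model P) (w : M.W) {Γ : List (Form P m)} {φ : Form P m}
    (h : M.Pos (Form.interp Γ φ).toModal w) (hΓ : ∀ ψ ∈ Γ, M.Pos ψ.toModal w) :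
    M.Pos φ.toModal w := by
  cases Γ with
  | nil => exact h
  | cons ψ l =>
    simp only [List.forall_mem_cons] at hΓ
    simp only [Form.interp, Form.toModal, Model.Pos] at h
    exact h w (M.le_refl w) (M.pos_conj w l ψ hΓ.1 hΓ.2)

/-! ### Decomposition of antecedents -/

/-- A measure lowered by every left rule read from conclusion to premise. Binary connectives count
twice, because the rule for `∼(φ ∨ χ)` turns one strong negation into two. -/
def Form.weight : Form P m → ℕ
  | .var _ => 1
  | .neg φ => φ.weight + 1
  | .and φ χ | .or φ χ | .imp φ χ => φ.weight + χ.weight + 2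
  | .box _ φ | .dia _ φ => φ.weight + 1

/-- The sum of the weights of the formulas in `Γ`. -/
def totalWeight (Γ : Multiset (Form P m)) : ℕ := (Γ.map Form.weight).sum

/-- `ψ` is decomposed in `X`: the formulas that a left rule puts in place of `ψ` (in one of its
premises, for a branching rule; in the right premise, for an implication) belong to `X`. -/
def Decomposed (X : Set (Form P m)) : Form P m → Prop
  | .neg (.neg φ) => φ ∈ X
  | .and φ χ => φ ∈ X ∧ χ ∈ X
  | .or φ χ => φ ∈ X ∨ χ ∈ X
  | .neg (.or φ χ) => .neg φ ∈ X ∧ .neg χ ∈ X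
  | .neg (.and φ χ) => .neg φ ∈ X ∨ .neg χ ∈ X
  | .imp _ χ => χ ∈ X
  | .neg (.imp φ χ) => φ ∈ X ∧ .neg χ ∈ X
  | _ => False

theorem Decomposed.mono {X Y : Set (Form P m)} (h : X ⊆ Y) {ψ : Form P m}
    (hψ : Decomposed X ψ) : Decomposed Y ψ := by
  unfold Decomposed at *
  split at hψ <;> grind

/-- No left rule applies usefully to `ψ` in the antecedent `Γ`: `ψ` is a literal, or its main
operator is modal, or it is an implication whose hypothesis is not provable from `Γ`. -/
def Stuck (R : Set ModalRule) (Γ : Multiset (Form P m)) : Form P m → Prop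
  | .var _ | .neg (.var _) | .box _ _ | .neg (.box _ _) | .dia _ _ | .neg (.dia _ _) => True
  | .imp φ _ => ¬ Provable R Γ φ
  | _ => False

/-- `Γ` does not prove the goal. The goal `none` is refuted by every antecedent. -/
def Refutes (R : Set ModalRule) (Γ : Multiset (Form P m)) (goal : Option (Form P m)) : Prop :=
  ∀ ψ ∈ goal, ¬ Provable R Γ ψ

theorem refutes_none (R : Set ModalRule) (Γ : Multiset (Form P m)) : Refutes R Γ none :=
  fun _ h => nomatch h

theorem refutes_some {R : Set ModalRule} {Γ : Multiset (Form P m)} {ψ : Form P m} :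
    Refutes R Γ (some ψ) ↔ ¬ Provable R Γ ψ := by
  simp [Refutes]

/-- For a branching left rule, one of the premises remains refutable. -/
theorem Refutes.or_of_provable {R : Set ModalRule} {Γ Γ₁ Γ₂ : Multiset (Form P m)}
    {goal : Option (Form P m)} (h : Refutes R Γ goal)
    (rule : ∀ ψ, Provable R Γ₁ ψ → Provable R Γ₂ ψ → Provable R Γ ψ) :
    Refutes R Γ₁ goal ∨ Refutes R Γ₂ goal := by
  cases goal with
  | none => exact .inl (refutes_none _ _)
  | some ψ =>
    simp only [refutes_some] at *
    exact not_and_or.mp fun h' => h (rule ψ h'.1 h'.2)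

/-- A formula that is not stuck can be replaced by lighter ones that decompose it, without making
the goal provable. -/
theorem Refutes.exists_replacement {R : Set ModalRule} {Γ : Multiset (Form P m)} {ψ : Form P m}
    {goal : Option (Form P m)} (h : Refutes R (ψ ::ₘ Γ) goal) (hψ : ¬ Stuck R (ψ ::ₘ Γ) ψ) :
    ∃ Δ : Multiset (Form P m), totalWeight Δ < ψ.weight ∧
      (∀ X : Set (Form P m), (∀ χ ∈ Δ, χ ∈ X) → Decomposed X ψ) ∧
      Refutes R (Δ + Γ) goal := by
  match ψ with
  | .var _ | .box _ _ | .dia _ _ | .neg (.var _) | .neg (.box _ _) | .neg (.dia _ _) =>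
    simp [Stuck] at hψ
  | .neg (.neg φ) =>
    refine ⟨{φ}, ?_, ?_, ?_⟩
    · simp [totalWeight, Form.weight]
    · simp [Decomposed]
    · exact fun θ hθ h' => h θ hθ (.negNegL _ _ _ h')
  | .and φ χ =>
    refine ⟨{φ, χ}, ?_, ?_, ?_⟩
    · simp [totalWeight, Form.weight]
    · simp [Decomposed]
    · exact fun θ hθ h' => h θ hθ (.andL _ _ _ _ (by simpa using h'))
  | .or φ χ =>
    rcases h.or_of_provable fun θ => Provable.orL Γ φ χ θ with h' | h'
    · refine ⟨{φ}, ?_, ?_, by simpa using h'⟩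
      · simp [totalWeight, Form.weight]; omega
      · simp +contextual [Decomposed]
    · refine ⟨{χ}, ?_, ?_, by simpa using h'⟩
      · simp [totalWeight, Form.weight]; omega
      · simp +contextual [Decomposed]
  | .neg (.or φ χ) =>
    refine ⟨{.neg φ, .neg χ}, ?_, ?_, ?_⟩
    · simp [totalWeight, Form.weight]; omega
    · simp [Decomposed]
    · exact fun θ hθ h' => h θ hθ (.negOrL _ _ _ _ (by simpa using h'))
  | .neg (.and φ χ) =>
    rcases h.or_of_provable fun θ => Provable.negAndL Γ φ χ θ with h' | h'
    · refine ⟨{.neg φ}, ?_, ?_, by simpa using h'⟩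
      · simp [totalWeight, Form.weight]; omega
      · simp +contextual [Decomposed]
    · refine ⟨{.neg χ}, ?_, ?_, by simpa using h'⟩
      · simp [totalWeight, Form.weight]; omega
      · simp +contextual [Decomposed]
  | .imp φ χ =>
    simp only [Stuck, not_not] at hψ
    refine ⟨{χ}, ?_, ?_, ?_⟩
    · simp [totalWeight, Form.weight]; omega
    · simp [Decomposed]
    · exact fun θ hθ h' => h θ hθ (.impL _ _ _ _ hψ (by simpa using h'))
  | .neg (.imp φ χ) =>
    refine ⟨{φ, .neg χ}, ?_, ?_, ?_⟩
    · simp [totalWeight, Form.weight]; omega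
    · simp [Decomposed]
    · exact fun θ hθ h' => h θ hθ (.negImpL _ _ _ _ (by simpa using h'))

/-! ### Canonical worlds -/

/-- A world of the canonical model: a set `X` of formulas to be supported, the residue `Γ` of the
decomposition of the antecedent, and an optional goal refuted by the residue. -/
structure World (P : Type u) (m : Bool) (R : Set ModalRule) : Type u where
  X : Set (Form P m)
  Γ : Multiset (Form P m)
  goal : Option (Form P m)
  refutes : Refutes R Γ goal
  saturated : ∀ ψ ∈ X, Decomposed X ψ ∨ ψ ∈ Γ ∧ Stuck R Γ ψ

theorem exists_world_of_refutes {R : Set ModalRule} {Γ : Multiset (Form P m)}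
    {goal : Option (Form P m)} (h : Refutes R Γ goal) {X : Set (Form P m)}
    (hX : ∀ ψ ∈ X, Decomposed X ψ ∨ ψ ∈ Γ) :
    ∃ w : World P m R, X ⊆ w.X ∧ w.goal = goal := by
  induction hn : totalWeight Γ using Nat.strong_induction_on generalizing Γ X with
  | _ n ih =>
  by_cases hs : ∀ ψ ∈ Γ, Stuck R Γ ψ
  · exact ⟨⟨X, Γ, goal, h, fun ψ hψ => (hX ψ hψ).imp id fun h' => ⟨h', hs ψ h'⟩⟩,
      subset_rfl, rfl⟩
  · push Not at hs
    obtain ⟨ψ, hψ, hns⟩ := hs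
    obtain ⟨Γ, rfl⟩ := Multiset.exists_cons_of_mem hψ
    obtain ⟨Δ, hw, hd, hr⟩ := h.exists_replacement hns
    have hlt : totalWeight (Δ + Γ) < n := by
      simp only [totalWeight, Multiset.map_add, Multiset.sum_add, Multiset.map_cons,
        Multiset.sum_cons] at *
      omega
    obtain ⟨w, hw, hg⟩ := ih _ hlt hr (X := X ∪ {χ | χ ∈ Δ}) (by
      rintro χ (hχ | hχ)
      · rcases hX χ hχ with h' | h'
        · exact .inl (h'.mono Set.subset_union_left)
        · rcases Multiset.mem_cons.mp h' with rfl | h'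
          · exact .inl (hd _ fun θ hθ => .inr hθ)
          · exact .inr (Multiset.mem_add.mpr (.inr h'))
      · exact .inr (Multiset.mem_add.mpr (.inl hχ))) rfl
    exact ⟨w, Set.subset_union_left.trans hw, hg⟩

theorem exists_world_of_mem {R : Set ModalRule} {Γ : Multiset (Form P m)}
    {goal : Option (Form P m)} (h : Refutes R Γ goal) :
    ∃ w : World P m R, (∀ ψ ∈ Γ, ψ ∈ w.X) ∧ w.goal = goal :=
  exists_world_of_refutes h (X := {ψ | ψ ∈ Γ}) fun _ hψ => .inr hψ

/-! ### Colourings of the modal slots -/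

/-- The four uses of an accessibility relation in the support clauses. -/
inductive Slot where
  | boxPos | boxNeg | diaPos | diaNeg
  deriving DecidableEq

/-- The formulas that a world with residue `Γ` passes on along the relation of colour `k`. Only
`□` (positively) and `◇` (negatively) are universal, so only the slots `boxPos` and `diaNeg`
matter. -/
def transfer (c : Slot → Slot) (k : Slot) (Γ : Multiset (Form P m)) : Multiset (Form P m) :=
  (if c .boxPos = k then boxPart Γ else 0) + (if c .diaNeg = k then negDiaPart Γ else 0)

/-- The formula that successors along the relation of colour `k` must not prove: the body of the
goal, if the goal is governed by an existential clause whose slot has colour `k`. -/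
def target (c : Slot → Slot) (k : Slot) : Option (Form P m) → Option (Form P m)
  | some (.dia _ χ) => if c .diaPos = k then some χ else none
  | some (.neg (.box _ χ)) => if c .boxNeg = k then some (.neg χ) else none
  | _ => none

/-- The calculus with the modal rules `R` is closed under the rules that the colouring `c` calls
for. -/
structure ModalClosed (P : Type u) (m : Bool) (R : Set ModalRule) (c : Slot → Slot) : Prop where
  box : ∀ (h : m = true) (Γ : Multiset (Form P m)) (χ : Form P m),
    Provable R (transfer c (c .boxPos) Γ) χ → Provable R Γ (.box h χ)
  negDia : ∀ (h : m = true) (Γ : Multiset (Form P m)) (χ : Form P m),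
    Provable R (transfer c (c .diaNeg) Γ) (.neg χ) → Provable R Γ (.neg (.dia h χ))
  dia : ∀ (h : m = true) (Γ : Multiset (Form P m)) (φ χ : Form P m),
    Provable R (φ ::ₘ transfer c (c .diaPos) Γ) χ → Provable R (.dia h φ ::ₘ Γ) (.dia h χ)
  negBox : ∀ (h : m = true) (Γ : Multiset (Form P m)) (φ χ : Form P m),
    Provable R (.neg φ ::ₘ transfer c (c .boxNeg) Γ) (.neg χ) →
      Provable R (.neg (.box h φ) ::ₘ Γ) (.neg (.box h χ))
  diaJoin : c .diaPos = c .boxNeg → ∀ (h : m = true) (Γ : Multiset (Form P m)) (φ χ : Form P m),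
    Provable R (.neg φ ::ₘ transfer c (c .boxNeg) Γ) χ →
      Provable R (.neg (.box h φ) ::ₘ Γ) (.dia h χ)
  negBoxJoin : c .diaPos = c .boxNeg → ∀ (h : m = true) (Γ : Multiset (Form P m))
    (φ χ : Form P m), Provable R (φ ::ₘ transfer c (c .diaPos) Γ) (.neg χ) →
      Provable R (.dia h φ ::ₘ Γ) (.neg (.box h χ))

/-- The colouring in which two slots have the same colour iff the logic identifies their
relations. It is immaterial for `N4`. -/
def Logic.colour : Logic → Slot → Slot
  | .n4, s => s
  | .cn4k, s => s
  | .pm, .boxPos | .pm, .diaPos => .boxPos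
  | .pm, .boxNeg | .pm, .diaNeg => .boxNeg
  | .curly, .boxPos | .curly, .boxNeg => .boxPos
  | .curly, .diaPos | .curly, .diaNeg => .diaPos
  | .join, .boxPos | .join, .diaNeg => .boxPos
  | .join, .diaPos | .join, .boxNeg => .diaPos
  | .one, _ => .boxPos

theorem Logic.modalClosed (P : Type u) (L : Logic) :
    ModalClosed P L.modal L.modalRules L.colour := by
  cases L with
  | n4 =>
    constructor
    all_goals intros; contradiction
  | cn4k =>
    constructor
    · intro h Γ χ hp
      exact .modal .box (by simp [modalRules]) _ _ _ _ (.box h Γ χ)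
        (by simpa [transfer, colour] using hp)
    · intro h Γ χ hp
      exact .modal .negDia (by simp [modalRules]) _ _ _ _ (.negDia h Γ χ)
        (by simpa [transfer, colour] using hp)
    · intro h Γ φ χ hp
      exact .modal .dia (by simp [modalRules]) _ _ _ _ (.dia h Γ φ χ)
        (by simpa [transfer, colour] using hp)
    · intro h Γ φ χ hp
      exact .modal .negBox (by simp [modalRules]) _ _ _ _ (.negBox h Γ φ χ)
        (by simpa [transfer, colour] using hp)
    · simp [colour]
    · simp [colour]
  | pm =>
    constructor
    · intro h Γ χ hp
      exact .modal .box (by simp [modalRules]) _ _ _ _ (.box h Γ χ)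
        (by simpa [transfer, colour] using hp)
    · intro h Γ χ hp
      exact .modal .negDia (by simp [modalRules]) _ _ _ _ (.negDia h Γ χ)
        (by simpa [transfer, colour] using hp)
    · intro h Γ φ χ hp
      exact .modal .diaPm (by simp [modalRules]) _ _ _ _ (.diaPm h Γ φ χ)
        (by simpa [transfer, colour] using hp)
    · intro h Γ φ χ hp
      exact .modal .negBoxPm (by simp [modalRules]) _ _ _ _ (.negBoxPm h Γ φ χ)
        (by simpa [transfer, colour] using hp)
    · simp [colour]
    · simp [colour]
  | curly =>
    constructor
    · intro h Γ χ hp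
      exact .modal .box (by simp [modalRules]) _ _ _ _ (.box h Γ χ)
        (by simpa [transfer, colour] using hp)
    · intro h Γ χ hp
      exact .modal .negDia (by simp [modalRules]) _ _ _ _ (.negDia h Γ χ)
        (by simpa [transfer, colour] using hp)
    · intro h Γ φ χ hp
      exact .modal .diaCurly (by simp [modalRules]) _ _ _ _ (.diaCurly h Γ φ χ)
        (by simpa [transfer, colour] using hp)
    · intro h Γ φ χ hp
      exact .modal .negBoxCurly (by simp [modalRules]) _ _ _ _ (.negBoxCurly h Γ φ χ)
        (by simpa [transfer, colour] using hp)
    · simp [colour]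
    · simp [colour]
  | join =>
    constructor
    · intro h Γ χ hp
      exact .modal .boxJoin (by simp [modalRules]) _ _ _ _ (.boxJoin h Γ χ)
        (by simpa [transfer, colour] using hp)
    · intro h Γ χ hp
      exact .modal .negDiaJoin (by simp [modalRules]) _ _ _ _ (.negDiaJoin h Γ χ)
        (by simpa [transfer, colour] using hp)
    · intro h Γ φ χ hp
      exact .modal .dia (by simp [modalRules]) _ _ _ _ (.dia h Γ φ χ)
        (by simpa [transfer, colour] using hp)
    · intro h Γ φ χ hp
      exact .modal .negBox (by simp [modalRules]) _ _ _ _ (.negBox h Γ φ χ)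
        (by simpa [transfer, colour] using hp)
    · intro _ h Γ φ χ hp
      exact .modal .diaJoin (by simp [modalRules]) _ _ _ _ (.diaJoin h Γ φ χ)
        (by simpa [transfer, colour] using hp)
    · intro _ h Γ φ χ hp
      exact .modal .negBoxJoin (by simp [modalRules]) _ _ _ _ (.negBoxJoin h Γ φ χ)
        (by simpa [transfer, colour] using hp)
  | one =>
    constructor
    · intro h Γ χ hp
      exact .modal .boxJoin (by simp [modalRules]) _ _ _ _ (.boxJoin h Γ χ)
        (by simpa [transfer, colour] using hp)
    · intro h Γ χ hp
      exact .modal .negDiaJoin (by simp [modalRules]) _ _ _ _ (.negDiaJoin h Γ χ)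
        (by simpa [transfer, colour] using hp)
    · intro h Γ φ χ hp
      exact .modal .diaOne (by simp [modalRules]) _ _ _ _ (.diaOne h Γ φ χ)
        (by simpa [transfer, colour] using hp)
    · intro h Γ φ χ hp
      exact .modal .negBoxOne (by simp [modalRules]) _ _ _ _ (.negBoxOne h Γ φ χ)
        (by simpa [transfer, colour] using hp)
    · intro _ h Γ φ χ hp
      exact .modal .diaOneJoin (by simp [modalRules]) _ _ _ _ (.diaOneJoin h Γ φ χ)
        (by simpa [transfer, colour] using hp)
    · intro _ h Γ φ χ hp
      exact .modal .negBoxOneJoin (by simp [modalRules]) _ _ _ _ (.negBoxOneJoin h Γ φ χ)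
        (by simpa [transfer, colour] using hp)

/-! ### The canonical model -/

/-- The canonical accessibility relation of colour `k`. -/
def World.Sees {R : Set ModalRule} (c : Slot → Slot) (k : Slot) (w v : World P m R) : Prop :=
  (∀ ψ ∈ transfer c k w.Γ, ψ ∈ v.X) ∧ Refutes R v.Γ (target c k w.goal)

/-- The canonical model. Each relation is the canonical one of the colour of its slot. -/
def canonical (P : Type u) (m : Bool) (R : Set ModalRule) (c : Slot → Slot) : Model P where
  W := World P m R
  nonempty := ⟨⟨∅, 0, none, refutes_none _ _, fun _ h => h.elim⟩⟩
  le w v := w.X ⊆ v.X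
  le_refl _ := subset_rfl
  le_trans _ _ _ h₁ h₂ := h₁.trans h₂
  boxPos := World.Sees c (c .boxPos)
  boxNeg := World.Sees c (c .boxNeg)
  diaPos := World.Sees c (c .diaPos)
  diaNeg := World.Sees c (c .diaNeg)
  vpos p := {w | .var p ∈ w.X}
  vneg p := {w | .neg (.var p) ∈ w.X}
  vpos_mono _ _ _ h hle := hle h
  vneg_mono _ _ _ h hle := hle h

section Truth

variable {R : Set ModalRule} {c : Slot → Slot}

/-- A world with the same formulas and another refuted goal; it lies above (and below) `w`. -/
def World.withGoal (w : World P m R) (goal : Option (Form P m)) (h : Refutes R w.Γ goal) :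
    World P m R :=
  { w with goal := goal, refutes := h }

theorem World.mem_residue_box (w : World P m R) {h : m = true} {φ : Form P m}
    (hφ : .box h φ ∈ w.X) : .box h φ ∈ w.Γ :=
  (w.saturated _ hφ).elim (fun h' => h'.elim) And.left

theorem World.mem_residue_dia (w : World P m R) {h : m = true} {φ : Form P m}
    (hφ : .dia h φ ∈ w.X) : .dia h φ ∈ w.Γ :=
  (w.saturated _ hφ).elim (fun h' => h'.elim) And.left

theorem World.mem_residue_negBox (w : World P m R) {h : m = true} {φ : Form P m}
    (hφ : .neg (.box h φ) ∈ w.X) : .neg (.box h φ) ∈ w.Γ :=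
  (w.saturated _ hφ).elim (fun h' => h'.elim) And.left

theorem World.mem_residue_negDia (w : World P m R) {h : m = true} {φ : Form P m}
    (hφ : .neg (.dia h φ) ∈ w.X) : .neg (.dia h φ) ∈ w.Γ :=
  (w.saturated _ hφ).elim (fun h' => h'.elim) And.left

theorem transfer_cons_dia (k : Slot) (h : m = true) (φ : Form P m) (Γ : Multiset (Form P m)) :
    transfer c k (.dia h φ ::ₘ Γ) = transfer c k Γ := by
  simp [transfer, boxPart, negDiaPart, Form.unbox, Form.unNegDia, Multiset.filterMap_cons]

theorem transfer_cons_negBox (k : Slot) (h : m = true) (φ : Form P m)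
    (Γ : Multiset (Form P m)) :
    transfer c k (.neg (.box h φ) ::ₘ Γ) = transfer c k Γ := by
  simp [transfer, boxPart, negDiaPart, Form.unbox, Form.unNegDia, Multiset.filterMap_cons]

theorem mem_transfer_boxPos {Γ : Multiset (Form P m)} {h : m = true} {φ : Form P m}
    (hφ : .box h φ ∈ Γ) : φ ∈ transfer c (c .boxPos) Γ := by
  simp only [transfer, if_true, Multiset.mem_add]
  exact .inl (Multiset.mem_filterMap _ _ |>.mpr ⟨_, hφ, rfl⟩)

theorem neg_mem_transfer_diaNeg {Γ : Multiset (Form P m)} {h : m = true} {φ : Form P m}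
    (hφ : .neg (.dia h φ) ∈ Γ) : .neg φ ∈ transfer c (c .diaNeg) Γ := by
  simp only [transfer, if_true, Multiset.mem_add]
  exact .inr (Multiset.mem_filterMap _ _ |>.mpr ⟨_, hφ, rfl⟩)

/-- If the premise antecedent of an existential modal rule refutes the target, there is a successor
that contains the side formula `ψ`. -/
theorem World.exists_sees (w : World P m R) {k : Slot} {ψ : Form P m}
    (h : Refutes R (ψ ::ₘ transfer c k w.Γ) (target c k w.goal)) :
    ∃ v : World P m R, w.Sees c k v ∧ ψ ∈ v.X := by
  obtain ⟨v, hv, hg⟩ := exists_world_of_mem h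
  exact ⟨v, ⟨fun χ hχ => hv χ (Multiset.mem_cons_of_mem hχ), hg ▸ v.refutes⟩,
    hv ψ (Multiset.mem_cons_self _ _)⟩

theorem World.exists_sees_of_dia (hc : ModalClosed P m R c) (w : World P m R) {h : m = true}
    {φ : Form P m} (hφ : .dia h φ ∈ w.X) :
    ∃ v : World P m R, w.Sees c (c .diaPos) v ∧ φ ∈ v.X := by
  apply w.exists_sees
  have hr := w.refutes
  obtain ⟨Γ, hΓ⟩ := Multiset.exists_cons_of_mem (w.mem_residue_dia hφ)
  rw [hΓ] at hr ⊢
  rw [transfer_cons_dia]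
  unfold target
  split
  · rename_i h' χ hg
    rw [hg, refutes_some] at hr
    rw [if_pos rfl, refutes_some]
    exact fun hp => hr (hc.dia h Γ φ χ hp)
  · rename_i h' χ hg
    rw [hg, refutes_some] at hr
    split_ifs with hk
    · rw [refutes_some]
      exact fun hp => hr (hc.negBoxJoin hk.symm h Γ φ χ hp)
    · exact refutes_none _ _
  · exact refutes_none _ _

theorem World.exists_sees_of_negBox (hc : ModalClosed P m R c) (w : World P m R) {h : m = true}
    {φ : Form P m} (hφ : .neg (.box h φ) ∈ w.X) :
    ∃ v : World P m R, w.Sees c (c .boxNeg) v ∧ .neg φ ∈ v.X := by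
  apply w.exists_sees
  have hr := w.refutes
  obtain ⟨Γ, hΓ⟩ := Multiset.exists_cons_of_mem (w.mem_residue_negBox hφ)
  rw [hΓ] at hr ⊢
  rw [transfer_cons_negBox]
  unfold target
  split
  · rename_i h' χ hg
    rw [hg, refutes_some] at hr
    split_ifs with hk
    · rw [refutes_some]
      exact fun hp => hr (hc.diaJoin hk h Γ φ χ hp)
    · exact refutes_none _ _
  · rename_i h' χ hg
    rw [hg, refutes_some] at hr
    rw [if_pos rfl, refutes_some]
    exact fun hp => hr (hc.negBox h Γ φ χ hp)
  · exact refutes_none _ _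

/-- If the premise of a universal modal rule is not provable, then `w`, with its goal removed, has
a successor refuting the right-hand side of that premise. -/
theorem World.exists_sees_refutes (w : World P m R) {k : Slot} {ψ : Form P m}
    (h : ¬ Provable R (transfer c k w.Γ) ψ) :
    ∃ v : World P m R, (w.withGoal none (refutes_none _ _)).Sees c k v ∧
      ¬ Provable R v.Γ ψ := by
  obtain ⟨v, hv, hg⟩ := exists_world_of_mem (refutes_some.mpr h)
  exact ⟨v, ⟨hv, refutes_none _ _⟩, refutes_some.mp (hg ▸ v.refutes)⟩

/-- A truth lemma for both supports, in the form suited to a calculus without cut: membership in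
`X` yields support, and unprovability from the residue (rather than non-membership) excludes it. -/
theorem truth (hc : ModalClosed P m R c) (φ : Form P m) : ∀ w : World P m R,
    ((φ ∈ w.X → (canonical P m R c).Pos φ.toModal w) ∧
      (¬ Provable R w.Γ φ → ¬ (canonical P m R c).Pos φ.toModal w)) ∧
    ((.neg φ ∈ w.X → (canonical P m R c).Neg φ.toModal w) ∧
      (¬ Provable R w.Γ (.neg φ) → ¬ (canonical P m R c).Neg φ.toModal w)) := by
  induction φ with
  | var p =>
    intro w
    refine ⟨⟨id, fun h hp => h ?_⟩, id, fun h hp => h ?_⟩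
    · obtain ⟨hm, -⟩ := (w.saturated _ hp).resolve_left id
      obtain ⟨Γ, hΓ⟩ := Multiset.exists_cons_of_mem hm
      exact hΓ ▸ .ax Γ p
    · obtain ⟨hm, -⟩ := (w.saturated _ hp).resolve_left id
      obtain ⟨Γ, hΓ⟩ := Multiset.exists_cons_of_mem hm
      exact hΓ ▸ .axNeg Γ p
  | neg φ ih =>
    intro w
    simp only [Form.toModal, Model.Pos, Model.Neg]
    refine ⟨(ih w).2, fun h => (ih w).1.1 ?_, fun h => (ih w).1.2 fun hp => h (.negNegR _ _ hp)⟩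
    exact (w.saturated _ h).resolve_right fun h' => h'.2
  | and φ χ ihφ ihχ =>
    intro w
    simp only [Form.toModal, Model.Pos, Model.Neg]
    obtain ⟨⟨a₁, a₂⟩, a₃, a₄⟩ := ihφ w
    obtain ⟨⟨b₁, b₂⟩, b₃, b₄⟩ := ihχ w
    refine ⟨⟨fun h => ?_, fun h ⟨h₁, h₂⟩ => h ?_⟩, fun h => ?_, fun h h' => ?_⟩
    · exact ((w.saturated _ h).resolve_right fun h' => h'.2).imp a₁ b₁
    · exact .andR _ _ _ (by_contra fun h' => a₂ h' h₁) (by_contra fun h' => b₂ h' h₂)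
    · exact ((w.saturated _ h).resolve_right fun h' => h'.2).imp a₃ b₃
    · exact h'.elim (a₄ fun hp => h (.negAndR₁ _ _ _ hp)) (b₄ fun hp => h (.negAndR₂ _ _ _ hp))
  | or φ χ ihφ ihχ =>
    intro w
    simp only [Form.toModal, Model.Pos, Model.Neg]
    obtain ⟨⟨a₁, a₂⟩, a₃, a₄⟩ := ihφ w
    obtain ⟨⟨b₁, b₂⟩, b₃, b₄⟩ := ihχ w
    refine ⟨⟨fun h => ?_, fun h h' => ?_⟩, fun h => ?_, fun h ⟨h₁, h₂⟩ => h ?_⟩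
    · exact ((w.saturated _ h).resolve_right fun h' => h'.2).imp a₁ b₁
    · exact h'.elim (a₂ fun hp => h (.orR₁ _ _ _ hp)) (b₂ fun hp => h (.orR₂ _ _ _ hp))
    · exact ((w.saturated _ h).resolve_right fun h' => h'.2).imp a₃ b₃
    · exact .negOrR _ _ _ (by_contra fun h' => a₄ h' h₁) (by_contra fun h' => b₄ h' h₂)
  | imp φ χ ihφ ihχ =>
    intro w
    simp only [Form.toModal, Model.Pos, Model.Neg]
    refine ⟨⟨fun h w' hle hφ => ?_, fun h hw => ?_⟩, fun h => ?_, fun h ⟨h₁, h₂⟩ => h ?_⟩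
    · refine (ihχ w').1.1 ((w'.saturated _ (hle h)).resolve_right fun h' => ?_)
      exact (ihφ w').1.2 h'.2 hφ
    · have hp : Refutes R (φ ::ₘ w.Γ) (some χ) := refutes_some.mpr fun hp => h (.impR _ _ _ hp)
      obtain ⟨v, hv, hg⟩ := exists_world_of_refutes hp (X := insert φ w.X) (by
        rintro ψ (rfl | hψ)
        · exact .inr (Multiset.mem_cons_self _ _)
        · exact (w.saturated ψ hψ).imp (fun h' => h'.mono (Set.subset_insert _ _))
            fun h' => Multiset.mem_cons_of_mem h'.1)
      refine (ihχ v).1.2 (refutes_some.mp (hg ▸ v.refutes)) ?_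
      exact hw v ((Set.subset_insert _ _).trans hv) ((ihφ v).1.1 (hv (Set.mem_insert _ _)))
    · exact ((w.saturated _ h).resolve_right fun h' => h'.2).imp (ihφ w).1.1 (ihχ w).2.1
    · exact .negImpR _ _ _ (by_contra fun h' => (ihφ w).1.2 h' h₁)
        (by_contra fun h' => (ihχ w).2.2 h' h₂)
  | box hm φ ih =>
    intro w
    simp only [Form.toModal, Model.Pos, Model.Neg]
    refine ⟨⟨fun h w' hle v hv => ?_, fun h hw => ?_⟩, fun h w' hle => ?_, fun h hw => ?_⟩
    · exact (ih v).1.1 (hv.1 _ (mem_transfer_boxPos (w'.mem_residue_box (hle h))))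
    · obtain ⟨v, hv, hp⟩ := w.exists_sees_refutes fun hp => h (hc.box hm _ _ hp)
      exact (ih v).1.2 hp (hw (w.withGoal none (refutes_none _ _)) (fun _ h' => h') v hv)
    · obtain ⟨v, hv, hφ⟩ := w'.exists_sees_of_negBox hc (hle h)
      exact ⟨v, hv, (ih v).2.1 hφ⟩
    · obtain ⟨v, hv, hφ⟩ := hw (w.withGoal _ (refutes_some.mpr h)) (fun _ h' => h')
      refine (ih v).2.2 (refutes_some.mp ?_) hφ
      simpa [target, World.withGoal] using hv.2
  | dia hm φ ih =>
    intro w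
    simp only [Form.toModal, Model.Pos, Model.Neg]
    refine ⟨⟨fun h w' hle => ?_, fun h hw => ?_⟩, fun h w' hle v hv => ?_, fun h hw => ?_⟩
    · obtain ⟨v, hv, hφ⟩ := w'.exists_sees_of_dia hc (hle h)
      exact ⟨v, hv, (ih v).1.1 hφ⟩
    · obtain ⟨v, hv, hφ⟩ := hw (w.withGoal _ (refutes_some.mpr h)) (fun _ h' => h')
      refine (ih v).1.2 (refutes_some.mp ?_) hφ
      simpa [target, World.withGoal] using hv.2
    · exact (ih v).2.1 (hv.1 _ (neg_mem_transfer_diaNeg (w'.mem_residue_negDia (hle h))))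
    · obtain ⟨v, hv, hp⟩ := w.exists_sees_refutes fun hp => h (hc.negDia hm _ _ hp)
      exact (ih v).2.2 hp (hw (w.withGoal none (refutes_none _ _)) (fun _ h' => h') v hv)

/-- A formula `⋀ Γ → φ` true throughout the canonical model comes from a provable sequent. -/
theorem provable_of_canonical (hc : ModalClosed P m R c) (Γ : List (Form P m)) (φ : Form P m)
    (h : ∀ w, (canonical P m R c).Pos (Form.interp Γ φ).toModal w) :
    Provable R (Γ : Multiset (Form P m)) φ := by
  by_contra hn
  obtain ⟨w, hw, hg⟩ := exists_world_of_mem (refutes_some.mpr hn)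
  refine (truth hc φ w).1.2 (refutes_some.mp (hg ▸ w.refutes)) ?_
  exact (canonical P m R c).pos_of_pos_interp w (h w) fun ψ hψ =>
    (truth hc ψ w).1.1 (hw ψ (by simpa using hψ))

end Truth

/-- Valid formulas hold throughout the canonical model of the logic, since equal colours give equal
relations. -/
theorem Logic.Valid.pos_canonical {L : Logic} {φ : Form P L.modal} (h : L.Valid φ)
    (w : (canonical P L.modal L.modalRules L.colour).W) :
    (canonical P L.modal L.modalRules L.colour).Pos φ.toModal w := by
  cases L with
  | n4 =>
    exact ((Model.toN4Model_support (canonical P _ _ _) φ w).1).mp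
      (h (canonical P _ _ _).toN4Model w)
  | cn4k => exact Model.pos_toModal _ _ (h _ w)
  | pm => exact Model.pos_toModal _ _ (h _ ⟨rfl, rfl⟩ w)
  | curly => exact Model.pos_toModal _ _ (h _ ⟨rfl, rfl⟩ w)
  | join => exact Model.pos_toModal _ _ (h _ ⟨rfl, rfl⟩ w)
  | one => exact Model.pos_toModal _ _ (h _ ⟨rfl, rfl, rfl⟩ w)

end CN4K

theorem mainTheorem4 {P : Type*} [Countable P] (L : CN4K.Logic)
    (Γ : List (CN4K.Form P L.modal)) (φ : CN4K.Form P L.modal)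
    (h : L.Valid (CN4K.Form.interp Γ φ)) :
    L.SequentProvable (Γ : Multiset (CN4K.Form P L.modal)) φ :=
  CN4K.provable_of_canonical (L.modalClosed P) Γ φ h.pos_canonical
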